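/- Let $1\le k\le d$ be integers, let $S_k(x)=\sum_{i_1<\dots<i_k}x_{i_1}\cdots x_{i_k}$ be the $k$-th elementary symmetric function of $x=(x_0,\dots,x_{d-1})$, and consider states on $\mathbb C^d\otimes\mathbb C^d$. For a unit vector $\psi=\sum_{i,j}a_{ij}\,|i\rangle|j\rangle$ with Schmidt numbers $\lambda=(\lambda_0,\dots,\lambda_{d-1})$ (the eigenvalues of $aa^\dagger$, with multiplicity and including zeros) put $$C_k(\psi)=\left(\frac{S_k(\lambda)}{S_k(1/d,\dots,1/d)}\right)^{1/k},$$ and for a density matrix $\rho$ put $C_k(\rho)=\min\sum_i p_iC_k(\psi_i)$, where the minimum is over all finite decompositions $\rho=\sum_ip_i|\psi_i\rangle\langle\psi_i|$ with $p_i\ge0$, $\sum_ip_i=1$, $\|\psi_i\|=1$. For a $d\times d$ density matrix $\sigma$ with vector of eigenvalues $\lambda(\sigma)$ put $f_k(\sigma)=\big(S_k(\lambda(\sigma))/S_k(1/d,\dots,1/d)\big)^{1/k}$. Then: 1. The minimum defining $C_k(\rho)$ is attained for every density matrix $\rho$, and $C_k(|\psi\rangle\langle\psi|)=C_k(\psi)$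 for every unit vector $\psi$. 2. $C_k(\psi)=f_k(\mathrm{Tr}_B|\psi\rangle\langle\psi|)$ for every unit vector $\psi$; $f_k(U\sigma U^\dagger)=f_k(\sigma)$ for every unitary $U$ and density matrix $\sigma$; and $f_k$ is concave on the set of $d\times d$ density matrices. 3. $C_k$ is an entanglement monotone, that is: - it does not increase on average under local operations and classical communication (LOCC): if a protocol consisting of finitely many rounds of local quantum instruments of Alice or Bob (given by finitely many Kraus operators, possibly changing the local dimensions on the way, each round allowed to depend on the earlier outcomes, and outcomes allowed to be forgotten) transforms a density matrix $\rho$ on $\mathbb C^d\otimes\mathbb C^d$ with probability $p_j$ into the density matrix $\rho_j$ on $\mathbb C^d\otimes\mathbb C^d$, $j=1,\dots,r$, then $\sum_jp_jC_k(\rho_j)\le C_k(\rho)$ (outcomes with $p_j=0$ contribute $0$); - it is convex on the set of density matrices of $\mathbb C^d\otimes\mathbb C^d$. -/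

import Mathlib

open scoped ComplexOrder Kronecker Matrix

noncomputable section

namespace Concurrence

/-- Operators on the bipartite space `ℂᵐ ⊗ ℂⁿ`, as matrices in the product basis
(Alice's index first, Bob's second). -/
abbrev BipartiteMatrix (m n : ℕ) : Type := Matrix (Fin m × Fin n) (Fin m × Fin n) ℂ

/-- Vectors of `ℂᵐ ⊗ ℂⁿ`; a pure state is a vector of norm one. -/
abbrev BipartiteVector (m n : ℕ) : Type := EuclideanSpace ℂ (Fin m × Fin n)

/-- Density matrices: positive semidefinite with trace one. -/
def IsDensity {ι : Type} [Fintype ι] (ρ : Matrix ι ι ℂ) : Prop :=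
  ρ.PosSemidef ∧ ρ.trace = 1

/-- The rank-one operator `|ψ⟩⟨ψ|`. -/
def ketBra {m n : ℕ} (ψ : BipartiteVector m n) : BipartiteMatrix m n :=
  Matrix.of fun x y => ψ x * star (ψ y)

/-- The partial trace over Bob's system. -/
def partialTraceB {m n : ℕ} (ρ : BipartiteMatrix m n) : Matrix (Fin m) (Fin m) ℂ :=
  Matrix.of fun i i' => ∑ j, ρ (i, j) (i', j)

/-! ### Concurrence monotones -/

/-- The `k`-th elementary symmetric function of `x₀, …, x_{d-1}`. -/
def elemSymm {d : ℕ} (k : ℕ) (x : Fin d → ℝ) : ℝ :=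
  ∑ s ∈ Finset.powersetCard k Finset.univ, ∏ i ∈ s, x i

/-- `(S_k(x) / S_k(1/d, …, 1/d)) ^ (1/k)`. -/
def normElemSymm {d : ℕ} (k : ℕ) (x : Fin d → ℝ) : ℝ :=
  (elemSymm k x / elemSymm k (fun _ : Fin d => 1 / (d : ℝ))) ^ (1 / (k : ℝ))

/-- The coefficient matrix `a` of `ψ = ∑ i j, a i j |i⟩|j⟩`. -/
def coeffMatrix {d : ℕ} (ψ : BipartiteVector d d) : Matrix (Fin d) (Fin d) ℂ :=
  Matrix.of fun i j => ψ (i, j)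

/-- The Schmidt numbers of `ψ` (the squares of its Schmidt coefficients, with multiplicity and
including zeros): the eigenvalues of `a aᴴ`, where `a` is the coefficient matrix of `ψ`. -/
def schmidtNumbers {d : ℕ} (ψ : BipartiteVector d d) : Fin d → ℝ :=
  (Matrix.isHermitian_mul_conjTranspose_self (coeffMatrix ψ)).eigenvalues

/-- `C_k` on pure states. -/
def pureConcurrence {d : ℕ} (k : ℕ) (ψ : BipartiteVector d d) : ℝ :=
  normElemSymm k (schmidtNumbers ψ)

/-- The average values `∑ pᵢ C_k(ψᵢ)` over all finite decompositions `ρ = ∑ pᵢ |ψᵢ⟩⟨ψᵢ|`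
into pure states. -/
def decompositionAverages {d : ℕ} (k : ℕ) (ρ : BipartiteMatrix d d) : Set ℝ :=
  {c | ∃ (N : ℕ) (p : Fin N → ℝ) (ψ : Fin N → BipartiteVector d d),
      (∀ i, 0 ≤ p i) ∧ ∑ i, p i = 1 ∧ (∀ i, ‖ψ i‖ = 1) ∧
      ρ = ∑ i, p i • ketBra (ψ i) ∧ c = ∑ i, p i * pureConcurrence k (ψ i)}

/-- `C_k` on mixed states: the convex roof of `C_k` on pure states. -/
def concurrence {d : ℕ} (k : ℕ) (ρ : BipartiteMatrix d d) : ℝ :=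
  sInf (decompositionAverages k ρ)

open Classical in
/-- The function `f_k(σ) = (S_k(λ(σ)) / S_k(1/d, …, 1/d)) ^ (1/k)` of the eigenvalues `λ(σ)` of a
Hermitian matrix (only its values at density matrices are of interest). -/
def spectralConcurrence {d : ℕ} (k : ℕ) (σ : Matrix (Fin d) (Fin d) ℂ) : ℝ :=
  if h : σ.IsHermitian then normElemSymm k h.eigenvalues else 0

/-! ### Local operations and classical communication -/

/-- A quantum instrument on one party's system, with input dimension `m`, output dimension `m'`
and `r` classical outcomes. The operation belonging to outcome `j` has the Kraus operators
`kraus j l`; several of them per outcome are allowed, so that information may be lost. -/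
structure Instrument (m m' r : ℕ) where
  numKraus : Fin r → ℕ
  kraus : (j : Fin r) → Fin (numKraus j) → Matrix (Fin m') (Fin m) ℂ
  complete : ∑ j, ∑ l, (kraus j l)ᴴ * kraus j l = 1

/-- The (unnormalised) state after Alice has applied `I` and obtained the outcome `j`. -/
def Instrument.onAlice {m m' r : ℕ} (I : Instrument m m' r) (n : ℕ) (j : Fin r)
    (ρ : BipartiteMatrix m n) : BipartiteMatrix m' n :=
  ∑ l, (I.kraus j l ⊗ₖ (1 : Matrix (Fin n) (Fin n) ℂ)) * ρ *
    (I.kraus j l ⊗ₖ (1 : Matrix (Fin n) (Fin n) ℂ))ᴴ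

/-- The (unnormalised) state after Bob has applied `I` and obtained the outcome `j`. -/
def Instrument.onBob {n n' r : ℕ} (I : Instrument n n' r) (m : ℕ) (j : Fin r)
    (ρ : BipartiteMatrix m n) : BipartiteMatrix m n' :=
  ∑ l, ((1 : Matrix (Fin m) (Fin m) ℂ) ⊗ₖ I.kraus j l) * ρ *
    ((1 : Matrix (Fin m) (Fin m) ℂ) ⊗ₖ I.kraus j l)ᴴ

/-- `IsLOCC Λ`: the family `Λ` of (unnormalised) state transformations, indexed by the final
classical outcomes, is realised by finitely many rounds of local operations and classical
communication. In `link`, the protocol `Γ i` that follows `Λ` may depend on the outcome `i` of `Λ`,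
and the joint outcomes are afterwards relabelled by `g`, which may forget part of the record.
The local dimensions may change on the way (ancillas may be added and subsystems discarded).
Taking them equal for all outcomes of a round is no restriction, as smaller spaces embed
isometrically into larger ones. -/
inductive IsLOCC : {m n m' n' r : ℕ} →
    (Fin r → BipartiteMatrix m n → BipartiteMatrix m' n') → Prop
  | alice {m m' n r : ℕ} (I : Instrument m m' r) : IsLOCC (I.onAlice n)
  | bob {m n n' r : ℕ} (I : Instrument n n' r) : IsLOCC (I.onBob m)
  | link {m n m' n' m'' n'' r t : ℕ} {s : Fin r → ℕ}
      (Λ : Fin r → BipartiteMatrix m n → BipartiteMatrix m' n')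
      (Γ : (i : Fin r) → Fin (s i) → BipartiteMatrix m' n' → BipartiteMatrix m'' n'')
      (g : (Σ i, Fin (s i)) → Fin t)
      (hΛ : IsLOCC Λ) (hΓ : ∀ i, IsLOCC (Γ i)) :
      IsLOCC (fun (q : Fin t) (ρ : BipartiteMatrix m n) =>
        ∑ x : (Σ i, Fin (s i)) with g x = q, Γ x.1 x.2 (Λ x.1 ρ))

/-- The probability of the outcome whose unnormalised final state is `σ`. -/
def outcomeProb {m n : ℕ} (σ : BipartiteMatrix m n) : ℝ := σ.trace.re

/-- The normalised final state (only relevant when the outcome has positive probability). -/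
def outcomeState {m n : ℕ} (σ : BipartiteMatrix m n) : BipartiteMatrix m n :=
  (outcomeProb σ)⁻¹ • σ

/-- `E` is an entanglement monotone on the states of a `d × d` system: it does not increase on
average under LOCC, and it does not increase when the information about which state of an ensemble
is present is discarded. -/
structure IsEntanglementMonotone {d : ℕ} (E : BipartiteMatrix d d → ℝ) : Prop where
  average_le : ∀ {r : ℕ} (Λ : Fin r → BipartiteMatrix d d → BipartiteMatrix d d), IsLOCC Λ →
    ∀ ρ : BipartiteMatrix d d, IsDensity ρ →
      ∑ j, outcomeProb (Λ j ρ) * E (outcomeState (Λ j ρ)) ≤ E ρ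
  convex : ConvexOn ℝ {ρ | IsDensity ρ} E

end Concurrence

end

/-! Everything rests on one function of a positive semidefinite matrix, `rootEsym`: the k-th root of
`e_k` of the eigenvalues. It is continuous, homogeneous of degree one, takes the same value at `A *
B` and `B * A`, and is superadditive (`rootEsym_superadditive`); homogeneity and superadditivity
give the concavity of `f_k`. Superadditivity holds first for nonnegative vectors
(`esym_rpow_superadditive`), since `e_k` is a telescoping product of ratios `e_{j+1}/e_j`, each
superadditive. Birkhoff's theorem then gives Schur concavity, which transfers the inequality to
matrices. The convex roof at `ρ` is the lowest point over `ρ` of the convex hull of the graph of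
`C_k` on pure states. This hull is compact, so the minimum is attained, and convexity of the roof is
immediate. For LOCC, a Kraus operator of Alice or Bob turns a coefficient matrix `A` into `K * A` or
`A * Kᵀ`. Completeness makes the resulting Gram matrices sum to `Aᴴ * A` or `A * Aᴴ`, so
superadditivity bounds the total of `rootEsym`. The bound passes to ensembles by addition and to
protocols by induction. It is run on unnormalised states and without the constant depending on `d`
(`rootCone`), because the local dimensions may vary. -/

noncomputable section

namespace Concurrence

/-! ### Elementary symmetric functions of real vectors and the Marcus–Lopes inequality. -/

section ElementarySymmetric

variable {ι : Type*}

/-- The `k`-th elementary symmetric function of the numbers `x i`, `i ∈ s`. -/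
def esym (s : Finset ι) (k : ℕ) (x : ι → ℝ) : ℝ :=
  ∑ t ∈ s.powersetCard k, ∏ i ∈ t, x i

lemma esym_zero (s : Finset ι) (x : ι → ℝ) : esym s 0 x = 1 := by
  simp [esym]

lemma esym_empty_succ (k : ℕ) (x : ι → ℝ) : esym ∅ (k + 1) x = 0 := by
  rw [esym, Finset.powersetCard_eq_empty.2 (by simp), Finset.sum_empty]

lemma esym_one (s : Finset ι) (x : ι → ℝ) : esym s 1 x = ∑ i ∈ s, x i := by
  simp [esym, Finset.powersetCard_one]

lemma esym_eq_zero {s : Finset ι} {k : ℕ} (h : s.card < k) (x : ι → ℝ) : esym s k x = 0 := by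
  simp [esym, Finset.powersetCard_eq_empty.2 h]

lemma esym_nonneg (s : Finset ι) (k : ℕ) {x : ι → ℝ} (hx : ∀ i, 0 ≤ x i) : 0 ≤ esym s k x :=
  Finset.sum_nonneg fun _ _ => Finset.prod_nonneg fun i _ => hx i

lemma esym_pos {s : Finset ι} {k : ℕ} (h : k ≤ s.card) {x : ι → ℝ} (hx : ∀ i, 0 < x i) :
    0 < esym s k x :=
  Finset.sum_pos (fun _ _ => Finset.prod_pos fun i _ => hx i) (Finset.powersetCard_nonempty.2 h)

lemma esym_smul (s : Finset ι) (k : ℕ) (c : ℝ) (x : ι → ℝ) :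
    esym s k (c • x) = c ^ k * esym s k x := by
  unfold esym
  rw [Finset.mul_sum]
  refine Finset.sum_congr rfl fun t ht => ?_
  simp [Finset.prod_mul_distrib, (Finset.mem_powersetCard.1 ht).2]

lemma continuous_esym (s : Finset ι) (k : ℕ) : Continuous (esym s k) := by
  unfold esym
  fun_prop

lemma esym_univ_comp_equiv [Fintype ι] (k : ℕ) (σ : Equiv.Perm ι) (x : ι → ℝ) :
    esym Finset.univ k (x ∘ σ) = esym Finset.univ k x := by
  unfold esym
  refine Finset.sum_bij' (fun t _ => t.map σ.toEmbedding) (fun t _ => t.map σ.symm.toEmbedding)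
    ?_ ?_ ?_ ?_ ?_ <;> simp [Finset.map_map]

/-- Mahler's inequality: the geometric mean is superadditive. -/
lemma geomMean_superadditive {k : ℕ} (hk : 1 ≤ k) {a b : ℕ → ℝ} (ha : ∀ i ∈ Finset.range k, 0 < a i)
    (hb : ∀ i ∈ Finset.range k, 0 < b i) :
    (∏ i ∈ Finset.range k, a i) ^ (1 / (k : ℝ)) + (∏ i ∈ Finset.range k, b i) ^ (1 / (k : ℝ)) ≤
      (∏ i ∈ Finset.range k, (a i + b i)) ^ (1 / (k : ℝ)) := by
  have hk0 : (k : ℝ) ≠ 0 := by positivity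
  have key : ∀ c : ℕ → ℝ, (∀ i ∈ Finset.range k, 0 < c i) →
      (∏ i ∈ Finset.range k, c i) ^ (1 / (k : ℝ)) ≤ ∑ i ∈ Finset.range k, 1 / (k : ℝ) * c i := by
    intro c hc
    rw [← Real.finsetProd_rpow _ _ fun i hi => (hc i hi).le]
    exact Real.geom_mean_le_arith_mean_weighted _ _ _ (fun i _ => by positivity)
      (by simp [hk0]) fun i hi => (hc i hi).le
  have hs : ∀ i ∈ Finset.range k, 0 < a i + b i := fun i hi => add_pos (ha i hi) (hb i hi)
  have h1 := key (fun i => a i / (a i + b i)) fun i hi => div_pos (ha i hi) (hs i hi)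
  have h2 := key (fun i => b i / (a i + b i)) fun i hi => div_pos (hb i hi) (hs i hi)
  have hsum : ∑ i ∈ Finset.range k, 1 / (k : ℝ) * (a i / (a i + b i)) +
      ∑ i ∈ Finset.range k, 1 / (k : ℝ) * (b i / (a i + b i)) = 1 := by
    rw [← Finset.sum_add_distrib]
    trans ∑ i ∈ Finset.range k, 1 / (k : ℝ)
    · refine Finset.sum_congr rfl fun i hi => ?_
      have := (hs i hi).ne'
      field_simp
    · simp [hk0]
  have hp : 0 < ∏ i ∈ Finset.range k, (a i + b i) := Finset.prod_pos hs
  rw [Finset.prod_div_distrib, Real.div_rpow (Finset.prod_pos ha).le hp.le] at h1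
  rw [Finset.prod_div_distrib, Real.div_rpow (Finset.prod_pos hb).le hp.le] at h2
  have h3 := add_le_add h1 h2
  rwa [hsum, ← add_div, div_le_one (Real.rpow_pos_of_pos hp _)] at h3

/-- Telescoping; it reduces `e_k ^ (1/k)` to a geometric mean of ratios of consecutive functions. -/
lemma prod_esym_ratio {s : Finset ι} {k : ℕ} (hk : k ≤ s.card) {x : ι → ℝ} (hx : ∀ i, 0 < x i) :
    ∏ j ∈ Finset.range k, esym s (j + 1) x / esym s j x = esym s k x := by
  induction k with
  | zero => simp [esym_zero]
  | succ k ih =>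
    rw [Finset.prod_range_succ, ih (by omega), mul_div_cancel₀]
    exact (esym_pos (by omega) hx).ne'

lemma esym_rpow_smul (s : Finset ι) {k : ℕ} (hk : 1 ≤ k) {c : ℝ} (hc : 0 ≤ c) {x : ι → ℝ}
    (hx : ∀ i, 0 ≤ x i) :
    esym s k (c • x) ^ (1 / (k : ℝ)) = c * esym s k x ^ (1 / (k : ℝ)) := by
  rw [esym_smul, Real.mul_rpow (by positivity) (esym_nonneg s k hx), one_div,
    Real.pow_rpow_inv_natCast hc (by omega)]

variable [DecidableEq ι]

lemma esym_insert {s : Finset ι} {a : ι} (ha : a ∉ s) (k : ℕ) (x : ι → ℝ) :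
    esym (insert a s) (k + 1) x = esym s (k + 1) x + x a * esym s k x := by
  have hmem : ∀ t ∈ s.powersetCard k, a ∉ t := fun t ht h =>
    ha ((Finset.mem_powersetCard.1 ht).1 h)
  unfold esym
  rw [Finset.powersetCard_succ_insert ha, Finset.sum_union, Finset.sum_image, Finset.mul_sum]
  · congr 1
    exact Finset.sum_congr rfl fun t ht => Finset.prod_insert (hmem t ht)
  · intro t ht u hu h
    rw [← Finset.erase_insert (hmem t ht), ← Finset.erase_insert (hmem u hu), h]
  · rw [Finset.disjoint_left]
    intro t ht h
    obtain ⟨u, -, rfl⟩ := Finset.mem_image.1 h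
    exact ha ((Finset.mem_powersetCard.1 ht).1 (Finset.mem_insert_self a u))

lemma esym_eq_add_erase {s : Finset ι} {a : ι} (ha : a ∈ s) (k : ℕ) (x : ι → ℝ) :
    esym s (k + 1) x = esym (s.erase a) (k + 1) x + x a * esym (s.erase a) k x := by
  conv_lhs => rw [← Finset.insert_erase ha]
  exact esym_insert (Finset.notMem_erase a s) k x

/-- Double counting: a (k+1)-subset arises once from each of its elements. -/
lemma succ_mul_esym (s : Finset ι) (k : ℕ) (x : ι → ℝ) :
    (k + 1 : ℝ) * esym s (k + 1) x = ∑ i ∈ s, x i * esym (s.erase i) k x := by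
  induction s using Finset.induction_on generalizing k with
  | empty => simp [esym_empty_succ]
  | insert a s ha ih =>
    rw [Finset.sum_insert ha, Finset.erase_insert ha, esym_insert ha]
    have herase : ∀ i ∈ s, (insert a s).erase i = insert a (s.erase i) := fun i hi =>
      Finset.erase_insert_of_ne fun h => ha (h ▸ hi)
    have hnot : ∀ i, a ∉ s.erase i := fun i h => ha (Finset.mem_of_mem_erase h)
    cases k with
    | zero => simp [esym_zero, esym_one]; ring
    | succ k =>
      have : ∑ i ∈ s, x i * esym ((insert a s).erase i) (k + 1) x =
          ∑ i ∈ s, x i * esym (s.erase i) (k + 1) x +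
            x a * ∑ i ∈ s, x i * esym (s.erase i) k x := by
        rw [Finset.mul_sum, ← Finset.sum_add_distrib]
        refine Finset.sum_congr rfl fun i hi => ?_
        rw [herase i hi, esym_insert (hnot i)]
        ring
      rw [this, ← ih, ← ih]
      push_cast
      ring

/-- The parallel sum `a * p / (a + p)` is superadditive, the defect being a multiple of `(a * q - b
* p) ^ 2`, and increasing in each argument, which allows `p + q` to be replaced by `r`. -/
lemma parallelSum_add_le {a b p q r : ℝ} (ha : 0 < a) (hb : 0 < b) (hp : 0 ≤ p) (hq : 0 ≤ q)
    (hr : p + q ≤ r) :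
    a * p / (a + p) + b * q / (b + q) ≤ (a + b) * r / (a + b + r) := by
  have h1 : a * p / (a + p) + b * q / (b + q) ≤ (a + b) * (p + q) / (a + b + (p + q)) := by
    rw [div_add_div _ _ (by positivity) (by positivity), div_le_div_iff₀ (by positivity)
      (by positivity)]
    nlinarith [sq_nonneg (a * q - b * p)]
  refine h1.trans ?_
  rw [div_le_div_iff₀ (by positivity) (by linarith)]
  nlinarith [mul_pos (add_pos ha hb) (add_pos ha hb)]

/-- Splitting `e_{k+1}` of `s` according to whether `i` is used makes each summand the parallel sum
of `x i` and a ratio of one degree less on `s.erase i`. This recursion drives the induction for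
superadditivity of the ratios. -/
lemma succ_mul_esym_div {s : Finset ι} {k : ℕ} (hk : k + 1 ≤ s.card) {x : ι → ℝ}
    (hx : ∀ i, 0 < x i) :
    (k + 2 : ℝ) * (esym s (k + 2) x / esym s (k + 1) x) =
      ∑ i ∈ s, x i * (esym (s.erase i) (k + 1) x / esym (s.erase i) k x) /
        (x i + esym (s.erase i) (k + 1) x / esym (s.erase i) k x) := by
  have h := succ_mul_esym s (k + 1) x
  push_cast at h
  rw [mul_div_assoc', show (k + 2 : ℝ) = k + 1 + 1 by ring, h, Finset.sum_div]
  refine Finset.sum_congr rfl fun i hi => ?_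
  have hc : k ≤ (s.erase i).card := by rw [Finset.card_erase_of_mem hi]; omega
  have hP := esym_pos hc hx
  have hQ := esym_nonneg (s.erase i) (k + 1) fun j => (hx j).le
  rw [esym_eq_add_erase hi]
  have := hx i
  field_simp
  ring

/-- The ratio of consecutive elementary symmetric functions is superadditive. -/
lemma esym_ratio_superadditive (k : ℕ) (s : Finset ι) (hk : k ≤ s.card) {x y : ι → ℝ}
    (hx : ∀ i, 0 < x i) (hy : ∀ i, 0 < y i) :
    esym s (k + 1) x / esym s k x + esym s (k + 1) y / esym s k y ≤
      esym s (k + 1) (x + y) / esym s k (x + y) := by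
  induction k generalizing s with
  | zero => simp [esym_zero, esym_one, Finset.sum_add_distrib]
  | succ k ih =>
    have hxy : ∀ i, 0 < (x + y) i := fun i => add_pos (hx i) (hy i)
    have hk2 : (0 : ℝ) < k + 2 := by positivity
    rw [← mul_le_mul_iff_right₀ hk2, mul_add, succ_mul_esym_div hk hx, succ_mul_esym_div hk hy,
      succ_mul_esym_div hk hxy, ← Finset.sum_add_distrib]
    refine Finset.sum_le_sum fun i hi => ?_
    have hc : k ≤ (s.erase i).card := by rw [Finset.card_erase_of_mem hi]; omega
    -- The induction hypothesis on `s.erase i` fills the slot `p + q ≤ r`.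
    exact parallelSum_add_le (hx i) (hy i)
      (div_nonneg (esym_nonneg _ _ fun j => (hx j).le) (esym_pos hc hx).le)
      (div_nonneg (esym_nonneg _ _ fun j => (hy j).le) (esym_pos hc hy).le)
      (ih (s.erase i) hc)

/-- Mahler's inequality for the telescoping product, followed by superadditivity of each ratio.
Positive entries keep the denominators nonzero. -/
lemma esym_rpow_superadditive_of_pos {s : Finset ι} {k : ℕ} (hk : 1 ≤ k) {x y : ι → ℝ}
    (hx : ∀ i, 0 < x i) (hy : ∀ i, 0 < y i) :
    esym s k x ^ (1 / (k : ℝ)) + esym s k y ^ (1 / (k : ℝ)) ≤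
      esym s k (x + y) ^ (1 / (k : ℝ)) := by
  have hk0 : 1 / (k : ℝ) ≠ 0 := by positivity
  rcases lt_or_ge s.card k with h | h
  · simp [esym_eq_zero h, Real.zero_rpow (by simpa using hk0 : (k : ℝ)⁻¹ ≠ 0)]
  have hxy : ∀ i, 0 < (x + y) i := fun i => add_pos (hx i) (hy i)
  have hpos : ∀ z : ι → ℝ, (∀ i, 0 < z i) → ∀ j ∈ Finset.range k,
      0 < esym s (j + 1) z / esym s j z := fun z hz j hj => by
    have := Finset.mem_range.1 hj
    exact div_pos (esym_pos (by omega) hz) (esym_pos (by omega) hz)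
  rw [← prod_esym_ratio h hx, ← prod_esym_ratio h hy, ← prod_esym_ratio h hxy]
  refine (geomMean_superadditive hk (hpos x hx) (hpos y hy)).trans ?_
  refine Real.rpow_le_rpow (Finset.prod_nonneg fun j hj =>
    (add_pos (hpos x hx j hj) (hpos y hy j hj)).le) ?_ (by positivity)
  refine Finset.prod_le_prod (fun j hj => (add_pos (hpos x hx j hj) (hpos y hy j hj)).le) ?_
  intro j hj
  have := Finset.mem_range.1 hj
  exact esym_ratio_superadditive j s (by omega) hx hy

/-- The Marcus–Lopes inequality: `e_k ^ (1/k)` is superadditive on nonnegative vectors. -/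
lemma esym_rpow_superadditive {s : Finset ι} {k : ℕ} (hk : 1 ≤ k) {x y : ι → ℝ}
    (hx : ∀ i, 0 ≤ x i) (hy : ∀ i, 0 ≤ y i) :
    esym s k x ^ (1 / (k : ℝ)) + esym s k y ^ (1 / (k : ℝ)) ≤
      esym s k (x + y) ^ (1 / (k : ℝ)) := by
  -- Nonnegative vectors are limits of positive ones: shift all entries by `ε` and let `ε` tend to
  -- zero from above.
  have hcont : Continuous fun z : ι → ℝ => esym s k z ^ (1 / (k : ℝ)) :=
    (continuous_esym s k).rpow_const fun _ => Or.inr (by positivity)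
  have hlim : ∀ z : ι → ℝ, Filter.Tendsto (fun ε : ℝ => esym s k (z + fun _ => ε) ^ (1 / (k : ℝ)))
      (nhdsWithin 0 (Set.Ioi 0)) (nhds (esym s k z ^ (1 / (k : ℝ)))) := by
    intro z
    have h : Continuous fun ε : ℝ => esym s k (z + fun _ => ε) ^ (1 / (k : ℝ)) :=
      hcont.comp (by fun_prop)
    have h0 := h.tendsto 0
    have hz : (z + fun _ => (0 : ℝ)) = z := by ext; simp
    rw [hz] at h0
    exact h0.mono_left nhdsWithin_le_nhds
  have hlim2 : Filter.Tendsto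
      (fun ε : ℝ => esym s k ((x + fun _ => ε) + (y + fun _ => ε)) ^ (1 / (k : ℝ)))
      (nhdsWithin 0 (Set.Ioi 0)) (nhds (esym s k (x + y) ^ (1 / (k : ℝ)))) := by
    have h : Continuous fun ε : ℝ =>
        esym s k ((x + fun _ => ε) + (y + fun _ => ε)) ^ (1 / (k : ℝ)) :=
      hcont.comp (by fun_prop)
    have h0 := h.tendsto 0
    have hz : ((x + fun _ => (0 : ℝ)) + (y + fun _ => (0 : ℝ))) = x + y := by ext; simp
    rw [hz] at h0
    exact h0.mono_left nhdsWithin_le_nhds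
  refine le_of_tendsto_of_tendsto ((hlim x).add (hlim y)) hlim2 ?_
  filter_upwards [self_mem_nhdsWithin] with ε hε
  exact esym_rpow_superadditive_of_pos hk (fun i => add_pos_of_nonneg_of_pos (hx i) hε)
    (fun i => add_pos_of_nonneg_of_pos (hy i) hε)

lemma esym_rpow_sum_le {κ : Type*} {s : Finset ι} {k : ℕ} (hk : 1 ≤ k) (u : Finset κ)
    (x : κ → ι → ℝ) (hx : ∀ j i, 0 ≤ x j i) :
    ∑ j ∈ u, esym s k (x j) ^ (1 / (k : ℝ)) ≤ esym s k (∑ j ∈ u, x j) ^ (1 / (k : ℝ)) := by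
  classical
  induction u using Finset.induction_on with
  | empty =>
    simp only [Finset.sum_empty]
    exact Real.rpow_nonneg (esym_nonneg s k fun _ => le_rfl) _
  | insert a u ha ih =>
    rw [Finset.sum_insert ha, Finset.sum_insert ha]
    refine (add_le_add_right ih _).trans (esym_rpow_superadditive hk (hx a) fun i => ?_)
    rw [Finset.sum_apply]
    exact Finset.sum_nonneg fun j _ => hx j i

/-- `e_k ^ (1/k)` does not decrease under doubly stochastic matrices. -/
lemma esym_rpow_le_mulVec [Fintype ι] {k : ℕ} (hk : 1 ≤ k) {D : Matrix ι ι ℝ}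
    (hD : D ∈ doublyStochastic ℝ ι) {x : ι → ℝ} (hx : ∀ i, 0 ≤ x i) :
    esym Finset.univ k x ^ (1 / (k : ℝ)) ≤ esym Finset.univ k (D *ᵥ x) ^ (1 / (k : ℝ)) := by
  -- By Birkhoff, `D *ᵥ x` is a convex combination of rearrangements of `x`, all with the same
  -- `e_k`; superadditivity and homogeneity finish.
  obtain ⟨w, hw0, hw1, rfl⟩ := exists_eq_sum_perm_of_mem_doublyStochastic hD
  have h : (∑ σ, w σ • σ.permMatrix ℝ) *ᵥ x = ∑ σ, w σ • (x ∘ σ) := by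
    rw [Matrix.sum_mulVec]
    refine Finset.sum_congr rfl fun σ _ => ?_
    rw [Matrix.smul_mulVec, Matrix.permMatrix_mulVec]
  rw [h]
  refine le_trans (le_of_eq ?_) (esym_rpow_sum_le hk Finset.univ (fun σ => w σ • (x ∘ σ))
    fun σ i => mul_nonneg (hw0 σ) (hx _))
  have hσ : ∀ σ : Equiv.Perm ι, esym Finset.univ k (w σ • (x ∘ σ)) ^ (1 / (k : ℝ)) =
      w σ * esym Finset.univ k x ^ (1 / (k : ℝ)) := fun σ => by
    rw [esym_rpow_smul Finset.univ hk (hw0 σ) (x := x ∘ σ) fun i => hx (σ i),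
      esym_univ_comp_equiv]
  simp_rw [hσ, ← Finset.sum_mul, hw1, one_mul]

end ElementarySymmetric

/-! ### Elementary symmetric functions of eigenvalues and their superadditivity on positive
semidefinite matrices. -/

section MatrixElementarySymmetric

open Polynomial in
/-- The `k`-th elementary symmetric function of the eigenvalues of `M`, as a coefficient of
`det (1 + X M)`. -/
def matEsym {n : Type*} [Fintype n] [DecidableEq n] (k : ℕ) (M : Matrix n n ℂ) : ℂ :=
  (Matrix.det (1 + (X : ℂ[X]) • M.map C)).coeff k

variable {m n : Type*} [Fintype m] [DecidableEq m] [Fintype n] [DecidableEq n]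

lemma matEsym_eq_sum_minors (k : ℕ) (M : Matrix n n ℂ) :
    matEsym k M = ∑ s ∈ Finset.univ.powersetCard k,
      (M.submatrix (Subtype.val : s → n) (Subtype.val : s → n)).det :=
  Matrix.coeff_det_one_add_X_smul_eq_sum_minors M k

lemma continuous_matEsym (k : ℕ) : Continuous (matEsym k : Matrix n n ℂ → ℂ) := by
  have h : (matEsym k : Matrix n n ℂ → ℂ) = fun M => ∑ s ∈ Finset.univ.powersetCard k,
      (M.submatrix (Subtype.val : s → n) (Subtype.val : s → n)).det :=
    funext (matEsym_eq_sum_minors k)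
  rw [h]
  fun_prop

lemma matEsym_smul (k : ℕ) (c : ℝ) (M : Matrix n n ℂ) :
    matEsym k (c • M) = (c : ℂ) ^ k * matEsym k M := by
  rw [matEsym_eq_sum_minors, matEsym_eq_sum_minors, Finset.mul_sum]
  refine Finset.sum_congr rfl fun s hs => ?_
  have h : (c • M).submatrix (Subtype.val : s → n) (Subtype.val : s → n) =
      (c : ℂ) • M.submatrix (Subtype.val : s → n) (Subtype.val : s → n) := by
    ext i j
    simp
  rw [h, Matrix.det_smul, Fintype.card_coe, (Finset.mem_powersetCard.1 hs).2]

open Polynomial in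
-- Sylvester's determinant identity. In `det (1 + X M)` the index of a coefficient does not shift
-- with the size of `M`, so rectangular factors are allowed.
lemma matEsym_mul_comm (k : ℕ) (A : Matrix m n ℂ) (B : Matrix n m ℂ) :
    matEsym k (A * B) = matEsym k (B * A) := by
  unfold matEsym
  rw [Matrix.map_mul, Matrix.map_mul, ← Matrix.smul_mul, Matrix.det_one_add_mul_comm,
    Matrix.mul_smul]

lemma matEsym_conj {U : Matrix n n ℂ} (hU : star U * U = 1) (k : ℕ) (M : Matrix n n ℂ) :
    matEsym k (U * M * star U) = matEsym k M := by
  rw [matEsym_mul_comm, ← Matrix.mul_assoc, hU, Matrix.one_mul]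

open Polynomial in
lemma matEsym_diagonal (k : ℕ) (x : n → ℝ) :
    matEsym k (Matrix.diagonal fun i => (x i : ℂ)) = (esym Finset.univ k x : ℂ) := by
  have h : ∀ t : Finset n, (∏ i ∈ t, (X * C (x i : ℂ) : ℂ[X])).coeff k =
      if t.card = k then ∏ i ∈ t, (x i : ℂ) else 0 := by
    intro t
    rw [Finset.prod_mul_distrib, Finset.prod_const, ← map_prod, coeff_X_pow_mul', coeff_C]
    by_cases h1 : t.card = k
    · simp [h1]
    · by_cases h2 : t.card ≤ k
      · simp [h1, h2, show k - t.card ≠ 0 by omega]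
      · simp [h1, h2]
  unfold matEsym
  rw [Matrix.diagonal_map (map_zero C), ← Matrix.diagonal_one, ← Matrix.diagonal_smul,
    Matrix.diagonal_add, Matrix.det_diagonal]
  simp only [Pi.smul_apply, smul_eq_mul, Finset.prod_one_add, finsetSum_coeff, h]
  rw [← Finset.sum_filter, esym, Finset.powersetCard_eq_filter]
  push_cast
  rfl

lemma eq_eigenvectorUnitary_mul {A : Matrix n n ℂ} (hA : A.IsHermitian) :
    A = (hA.eigenvectorUnitary : Matrix n n ℂ) *
      (Matrix.diagonal fun i => (hA.eigenvalues i : ℂ)) *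
      star (hA.eigenvectorUnitary : Matrix n n ℂ) := by
  conv_lhs => rw [hA.spectral_theorem, Unitary.conjStarAlgAut_apply]
  rfl

lemma matEsym_eq_eigenvalues {A : Matrix n n ℂ} (hA : A.IsHermitian) (k : ℕ) :
    matEsym k A = (esym Finset.univ k hA.eigenvalues : ℂ) := by
  conv_lhs => rw [eq_eigenvectorUnitary_mul hA]
  rw [matEsym_conj (Unitary.coe_star_mul_self _), matEsym_diagonal]

/-- The `k`-th root of the `k`-th elementary symmetric function of the eigenvalues. -/
def rootEsym (k : ℕ) (M : Matrix n n ℂ) : ℝ := (matEsym k M).re ^ (1 / (k : ℝ))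

lemma rootEsym_eq_eigenvalues {A : Matrix n n ℂ} (hA : A.IsHermitian) (k : ℕ) :
    rootEsym k A = esym Finset.univ k hA.eigenvalues ^ (1 / (k : ℝ)) := by
  rw [rootEsym, matEsym_eq_eigenvalues hA, Complex.ofReal_re]

lemma rootEsym_nonneg {A : Matrix n n ℂ} (hA : A.PosSemidef) (k : ℕ) : 0 ≤ rootEsym k A := by
  rw [rootEsym_eq_eigenvalues hA.1]
  exact Real.rpow_nonneg (esym_nonneg _ _ hA.eigenvalues_nonneg) _

lemma continuous_rootEsym (k : ℕ) : Continuous (rootEsym k : Matrix n n ℂ → ℝ) :=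
  (Complex.continuous_re.comp (continuous_matEsym k)).rpow_const fun _ => Or.inr (by positivity)

lemma rootEsym_mul_comm (k : ℕ) (A : Matrix m n ℂ) (B : Matrix n m ℂ) :
    rootEsym k (A * B) = rootEsym k (B * A) := by
  rw [rootEsym, rootEsym, matEsym_mul_comm]

lemma rootEsym_smul {k : ℕ} (hk : 1 ≤ k) {c : ℝ} (hc : 0 ≤ c) {A : Matrix n n ℂ}
    (hA : A.PosSemidef) : rootEsym k (c • A) = c * rootEsym k A := by
  have h : (matEsym k (c • A)).re = c ^ k * (matEsym k A).re := by
    rw [matEsym_smul, ← Complex.ofReal_pow, Complex.re_ofReal_mul]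
  have h0 : 0 ≤ (matEsym k A).re := by
    rw [matEsym_eq_eigenvalues hA.1, Complex.ofReal_re]
    exact esym_nonneg _ _ hA.eigenvalues_nonneg
  rw [rootEsym, h, Real.mul_rpow (by positivity) h0, one_div,
    Real.pow_rpow_inv_natCast hc (by omega), rootEsym, one_div]

lemma normSq_unitary_mem_doublyStochastic {U : Matrix n n ℂ}
    (hU : U ∈ Matrix.unitaryGroup n ℂ) :
    (Matrix.of fun i j => Complex.normSq (U i j)) ∈ doublyStochastic ℝ n := by
  rw [mem_doublyStochastic_iff_sum]
  refine ⟨fun i j => Complex.normSq_nonneg _, fun i => ?_, fun j => ?_⟩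
  · have h := congrFun (congrFun (Matrix.mem_unitaryGroup_iff.1 hU) i) i
    rw [Matrix.mul_apply, Matrix.one_apply_eq] at h
    have h' : ((∑ j, Complex.normSq (U i j) : ℝ) : ℂ) = 1 := by
      rw [← h, Complex.ofReal_sum]
      refine Finset.sum_congr rfl fun j _ => ?_
      rw [← Complex.mul_conj, Matrix.star_apply]
      rfl
    exact_mod_cast h'
  · have h := congrFun (congrFun (Matrix.mem_unitaryGroup_iff'.1 hU) j) j
    rw [Matrix.mul_apply, Matrix.one_apply_eq] at h
    have h' : ((∑ i, Complex.normSq (U i j) : ℝ) : ℂ) = 1 := by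
      rw [← h, Complex.ofReal_sum]
      refine Finset.sum_congr rfl fun i _ => ?_
      rw [Complex.normSq_eq_conj_mul_self, Matrix.star_apply]
      rfl
    exact_mod_cast h'

lemma diag_eq_mulVec_eigenvalues {A : Matrix n n ℂ} (hA : A.IsHermitian) :
    (fun i => (A i i).re) =
      (Matrix.of fun i j => Complex.normSq ((hA.eigenvectorUnitary : Matrix n n ℂ) i j)) *ᵥ
        hA.eigenvalues := by
  ext i
  have h : A i i = ((∑ j, Complex.normSq ((hA.eigenvectorUnitary : Matrix n n ℂ) i j) *
      hA.eigenvalues j : ℝ) : ℂ) := by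
    conv_lhs => rw [eq_eigenvectorUnitary_mul hA]
    rw [Matrix.mul_apply, Complex.ofReal_sum]
    refine Finset.sum_congr rfl fun j _ => ?_
    rw [Matrix.mul_diagonal, Matrix.star_apply, Complex.ofReal_mul, ← Complex.mul_conj]
    simp only [RCLike.star_def]
    ring
  rw [h, Complex.ofReal_re]
  rfl

/-- Schur: passing to the diagonal does not decrease `e_k ^ (1/k)`. -/
lemma rootEsym_le_diag {k : ℕ} (hk : 1 ≤ k) {A : Matrix n n ℂ} (hA : A.PosSemidef) :
    rootEsym k A ≤ esym Finset.univ k (fun i => (A i i).re) ^ (1 / (k : ℝ)) := by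
  rw [rootEsym_eq_eigenvalues hA.1, diag_eq_mulVec_eigenvalues hA.1]
  exact esym_rpow_le_mulVec hk
    (normSq_unitary_mem_doublyStochastic (hA.1.eigenvectorUnitary).2) hA.eigenvalues_nonneg

/-- In an eigenbasis of `A + B` the eigenvalues of the sum are the diagonal of `A` plus that of `B`.
Schur's inequality bounds each matrix by its diagonal, and the vector inequality combines the two
diagonals. -/
lemma rootEsym_superadditive {k : ℕ} (hk : 1 ≤ k) {A B : Matrix n n ℂ} (hA : A.PosSemidef)
    (hB : B.PosSemidef) : rootEsym k A + rootEsym k B ≤ rootEsym k (A + B) := by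
  have hC := hA.1.add hB.1
  set U : Matrix n n ℂ := (hC.eigenvectorUnitary : Matrix n n ℂ) with hUdef
  have hU : star U * U = 1 := Unitary.coe_star_mul_self _
  have hU' : U * star U = 1 := Unitary.coe_mul_star_self _
  have hroot : ∀ M : Matrix n n ℂ, rootEsym k (star U * M * U) = rootEsym k M := fun M => by
    have h := matEsym_conj (U := star U) (by rwa [star_star]) k M
    rw [star_star] at h
    rw [rootEsym, h, rootEsym]
  have hpsd : ∀ M : Matrix n n ℂ, M.PosSemidef → (star U * M * U).PosSemidef := fun M hM =>
    hM.conjTranspose_mul_mul_same U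
  have hsum : star U * A * U + star U * B * U =
      Matrix.diagonal fun i => (hC.eigenvalues i : ℂ) := by
    rw [← Matrix.add_mul, ← Matrix.mul_add]
    conv_lhs => rw [eq_eigenvectorUnitary_mul hC, ← hUdef]
    rw [← Matrix.mul_assoc, ← Matrix.mul_assoc, hU, Matrix.one_mul, Matrix.mul_assoc, hU,
      Matrix.mul_one]
  have hdiag : hC.eigenvalues = (fun i => ((star U * A * U) i i).re) +
      fun i => ((star U * B * U) i i).re := by
    ext i
    have h := congrArg Complex.re (congrFun (congrFun hsum i) i)
    rw [Matrix.add_apply, Matrix.diagonal_apply_eq, Complex.ofReal_re, Complex.add_re] at h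
    exact h.symm
  have hnn : ∀ M : Matrix n n ℂ, M.PosSemidef → ∀ i, 0 ≤ ((star U * M * U) i i).re :=
    fun M hM i => (Complex.nonneg_iff.1 ((hpsd M hM).diag_nonneg)).1
  rw [rootEsym_eq_eigenvalues hC, hdiag, ← hroot A, ← hroot B]
  exact (add_le_add (rootEsym_le_diag hk (hpsd A hA)) (rootEsym_le_diag hk (hpsd B hB))).trans
    (esym_rpow_superadditive hk (hnn A hA) (hnn B hB))

lemma rootEsym_sum_le {κ : Type*} {k : ℕ} (hk : 1 ≤ k) (u : Finset κ) (A : κ → Matrix n n ℂ)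
    (hA : ∀ j, (A j).PosSemidef) :
    ∑ j ∈ u, rootEsym k (A j) ≤ rootEsym k (∑ j ∈ u, A j) := by
  classical
  induction u using Finset.induction_on with
  | empty =>
    simp only [Finset.sum_empty]
    exact rootEsym_nonneg Matrix.PosSemidef.zero k
  | insert a u ha ih =>
    rw [Finset.sum_insert ha, Finset.sum_insert ha]
    exact (add_le_add_right ih _).trans
      (rootEsym_superadditive hk (hA a) (Matrix.posSemidef_sum u fun j _ => hA j))

end MatrixElementarySymmetric

/-- In finite dimension the convex hull of a compact set is compact. -/
theorem isCompact_convexHull_of_isCompact {E : Type*} [AddCommGroup E] [Module ℝ E]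
    [FiniteDimensional ℝ E] [TopologicalSpace E] [ContinuousAdd E] [ContinuousSMul ℝ E]
    {K : Set E} (hK : IsCompact K) : IsCompact (convexHull ℝ K) := by
  -- By Carathéodory, `finrank + 1` points suffice, so the hull is a continuous image of a simplex
  -- times `K ^ N`.
  set N := Module.finrank ℝ E + 1 with hN
  set Φ : (Fin N → ℝ) × (Fin N → E) → E := fun q => ∑ i, q.1 i • q.2 i with hΦ
  have himg : convexHull ℝ K = Φ '' (stdSimplex ℝ (Fin N) ×ˢ Set.univ.pi fun _ => K) := by
    apply Set.Subset.antisymm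
    · intro x hx
      rw [convexHull_eq_union] at hx
      simp only [Set.mem_iUnion] at hx
      obtain ⟨t, htK, hind, hxt⟩ := hx
      have hcard : Fintype.card t ≤ Fintype.card (Fin N) := by
        rw [Fintype.card_fin]
        exact hind.card_le_finrank_succ.trans (Nat.succ_le_succ (Submodule.finrank_le _))
      obtain ⟨e⟩ := Function.Embedding.nonempty_of_card_le hcard
      have hne : t.Nonempty := by
        rw [Finset.nonempty_iff_ne_empty]
        rintro rfl
        simp at hxt
      have : Nonempty t := hne.to_subtype
      -- Pads the at most `N` points of `t` to exactly `N` by repetition.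
      set g : Fin N → E := fun i => (Function.invFun e i : t) with hg
      have hgK : ∀ i, g i ∈ K := fun i => htK (Function.invFun e i).2
      have hsub : (t : Set E) ⊆ Fintype.linearCombination ℝ g '' stdSimplex ℝ (Fin N) := by
        intro y hy
        refine ⟨Pi.single (e ⟨y, hy⟩) 1, single_mem_stdSimplex ℝ _, ?_⟩
        rw [Fintype.linearCombination_apply_single, one_smul, hg]
        simp only [Function.leftInverse_invFun e.injective _]
      obtain ⟨w, hw, hwx⟩ := convexHull_min hsub
        ((convex_stdSimplex ℝ (Fin N)).linear_image _) hxt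
      exact ⟨(w, g), ⟨hw, fun i _ => hgK i⟩, hwx⟩
    · rintro _ ⟨⟨w, z⟩, ⟨hw, hz⟩, rfl⟩
      exact mem_convexHull_of_exists_fintype w z hw.1 hw.2 (fun i => hz i trivial) rfl
  rw [himg]
  refine ((isCompact_stdSimplex ℝ (Fin N)).prod (isCompact_univ_pi fun _ => hK)).image ?_
  fun_prop

/-! ### Pure states -/

/-- The normalising constant `S_k(1/d, …, 1/d) ^ (1/k)`. -/
def uniformRoot (d k : ℕ) : ℝ :=
  esym Finset.univ k (fun _ : Fin d => 1 / (d : ℝ)) ^ (1 / (k : ℝ))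

lemma uniformRoot_pos {d k : ℕ} (hk : 1 ≤ k) (hkd : k ≤ d) : 0 < uniformRoot d k := by
  have hd : (0 : ℝ) < d := by exact_mod_cast hk.trans hkd
  exact Real.rpow_pos_of_pos (esym_pos (by simpa using hkd) fun _ => by positivity) _

lemma normElemSymm_eigenvalues {d : ℕ} (k : ℕ) {A : Matrix (Fin d) (Fin d) ℂ}
    (hA : A.PosSemidef) :
    normElemSymm k hA.1.eigenvalues = rootEsym k A / uniformRoot d k := by
  rw [rootEsym_eq_eigenvalues hA.1, uniformRoot, ← Real.div_rpow]
  · rfl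
  · exact esym_nonneg _ _ hA.eigenvalues_nonneg
  · exact esym_nonneg _ _ fun _ => by positivity

lemma pureConcurrence_eq {d : ℕ} (k : ℕ) (ψ : BipartiteVector d d) :
    pureConcurrence k ψ =
      rootEsym k (coeffMatrix ψ * (coeffMatrix ψ)ᴴ) / uniformRoot d k :=
  normElemSymm_eigenvalues k (Matrix.posSemidef_self_mul_conjTranspose _)

lemma spectralConcurrence_eq {d : ℕ} (k : ℕ) {σ : Matrix (Fin d) (Fin d) ℂ}
    (hσ : σ.PosSemidef) : spectralConcurrence k σ = rootEsym k σ / uniformRoot d k := by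
  rw [spectralConcurrence, dif_pos hσ.1]
  exact normElemSymm_eigenvalues k hσ

lemma partialTraceB_ketBra {d : ℕ} (ψ : BipartiteVector d d) :
    partialTraceB (ketBra ψ) = coeffMatrix ψ * (coeffMatrix ψ)ᴴ := by
  ext i j
  simp [partialTraceB, ketBra, coeffMatrix, Matrix.mul_apply]

lemma uniformRoot_nonneg (d k : ℕ) : 0 ≤ uniformRoot d k :=
  Real.rpow_nonneg (esym_nonneg _ _ fun _ => by positivity) _

lemma pureConcurrence_nonneg {d : ℕ} (k : ℕ) (ψ : BipartiteVector d d) :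
    0 ≤ pureConcurrence k ψ := by
  rw [pureConcurrence_eq]
  exact div_nonneg (rootEsym_nonneg (Matrix.posSemidef_self_mul_conjTranspose _) k)
    (uniformRoot_nonneg d k)

lemma continuous_coeffMatrix {d : ℕ} :
    Continuous (coeffMatrix : BipartiteVector d d → Matrix (Fin d) (Fin d) ℂ) := by
  unfold coeffMatrix
  fun_prop

lemma continuous_pureConcurrence {d : ℕ} (k : ℕ) :
    Continuous (pureConcurrence k : BipartiteVector d d → ℝ) := by
  have h : (pureConcurrence k : BipartiteVector d d → ℝ) = fun ψ =>
      rootEsym k (coeffMatrix ψ * (coeffMatrix ψ)ᴴ) / uniformRoot d k :=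
    funext (pureConcurrence_eq k)
  rw [h]
  have hc : Continuous fun ψ : BipartiteVector d d => coeffMatrix ψ * (coeffMatrix ψ)ᴴ :=
    continuous_coeffMatrix.matrix_mul continuous_coeffMatrix.matrix_conjTranspose
  exact ((continuous_rootEsym k).comp hc).div_const _

lemma continuous_ketBra {m n : ℕ} :
    Continuous (ketBra : BipartiteVector m n → BipartiteMatrix m n) := by
  unfold ketBra
  fun_prop

lemma ketBra_smul {m n : ℕ} (c : ℂ) (ψ : BipartiteVector m n) :
    ketBra (c • ψ) = (‖c‖ ^ 2 : ℝ) • ketBra ψ := by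
  ext x y
  simp only [ketBra, Matrix.of_apply, PiLp.smul_apply, smul_eq_mul, star_mul', Matrix.smul_apply,
    Complex.real_smul]
  rw [← Complex.normSq_eq_norm_sq, ← Complex.mul_conj]
  simp only [RCLike.star_def]
  ring

lemma coeffMatrix_mul_conjTranspose_smul {d : ℕ} (c : ℂ) (ψ : BipartiteVector d d) :
    coeffMatrix (c • ψ) * (coeffMatrix (c • ψ))ᴴ =
      (‖c‖ ^ 2 : ℝ) • (coeffMatrix ψ * (coeffMatrix ψ)ᴴ) := by
  rw [← partialTraceB_ketBra, ← partialTraceB_ketBra, ketBra_smul]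
  ext i j
  simp [partialTraceB, Finset.mul_sum]

/-- Degree two in the vector means degree one in the state, so a weight `p` can be absorbed into the
vector as the factor `√p`. -/
lemma pureConcurrence_smul {d k : ℕ} (hk : 1 ≤ k) (c : ℂ) (ψ : BipartiteVector d d) :
    pureConcurrence k (c • ψ) = ‖c‖ ^ 2 * pureConcurrence k ψ := by
  rw [pureConcurrence_eq, pureConcurrence_eq, coeffMatrix_mul_conjTranspose_smul,
    rootEsym_smul hk (by positivity) (Matrix.posSemidef_self_mul_conjTranspose _), mul_div_assoc]

lemma trace_ketBra {m n : ℕ} (ψ : BipartiteVector m n) :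
    (ketBra ψ).trace = ((‖ψ‖ ^ 2 : ℝ) : ℂ) := by
  rw [EuclideanSpace.norm_sq_eq, Complex.ofReal_sum]
  refine Finset.sum_congr rfl fun x _ => ?_
  rw [← Complex.normSq_eq_norm_sq, ← Complex.mul_conj]
  rfl

lemma star_dotProduct_ketBra_mulVec {m n : ℕ} (φ ψ : BipartiteVector m n) :
    (star ⇑ψ ⬝ᵥ (ketBra φ *ᵥ ⇑ψ)).re = ‖inner ℂ ψ φ‖ ^ 2 := by
  have h : ketBra φ *ᵥ ⇑ψ = inner ℂ φ ψ • ⇑φ := by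
    ext x
    simp only [ketBra, Matrix.mulVec, dotProduct, Matrix.of_apply, PiLp.inner_apply, Pi.smul_apply,
      smul_eq_mul, Finset.sum_mul, RCLike.inner_apply, RCLike.star_def]
    exact Finset.sum_congr rfl fun y _ => by ring
  rw [h, dotProduct_smul, dotProduct_comm, ← EuclideanSpace.inner_eq_star_dotProduct,
    ← inner_conj_symm φ ψ, smul_eq_mul, mul_comm, Complex.mul_conj, Complex.ofReal_re,
    Complex.normSq_eq_norm_sq]

/-! ### The convex roof as a slice of a convex hull -/

/-- The graph of `C_k` over the pure states. -/
def pureGraph (d k : ℕ) : Set (BipartiteMatrix d d × ℝ) :=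
  (fun ψ : BipartiteVector d d => (ketBra ψ, pureConcurrence k ψ)) '' Metric.sphere 0 1

lemma mk_mem_pureGraph {d : ℕ} (k : ℕ) {ψ : BipartiteVector d d} (hψ : ‖ψ‖ = 1) :
    (ketBra ψ, pureConcurrence k ψ) ∈ pureGraph d k :=
  ⟨ψ, by simpa using hψ, rfl⟩

lemma mem_decompositionAverages_iff {d k : ℕ} {ρ : BipartiteMatrix d d} {c : ℝ} :
    c ∈ decompositionAverages k ρ ↔ (ρ, c) ∈ convexHull ℝ (pureGraph d k) := by
  constructor
  · rintro ⟨N, p, ψ, hp, hp1, hψ, rfl, rfl⟩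
    refine mem_convexHull_of_exists_fintype p
      (fun i => (ketBra (ψ i), pureConcurrence k (ψ i))) hp hp1
      (fun i => mk_mem_pureGraph k (hψ i)) ?_
    ext1
    · simp [Prod.fst_sum]
    · simp [Prod.snd_sum]
  · intro h
    obtain ⟨ι, _, w, z, hw, hw1, hz, hsum⟩ := mem_convexHull_iff_exists_fintype.1 h
    choose ψ hψ hψz using hz
    have e := (Fintype.equivFin ι).symm
    refine ⟨Fintype.card ι, w ∘ e, ψ ∘ e, fun i => hw _, ?_, fun i => by simpa using hψ (e i),
      ?_, ?_⟩
    · rw [← hw1]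
      exact e.sum_comp w
    · rw [show ρ = _ from (congrArg Prod.fst hsum).symm, Prod.fst_sum, ← e.sum_comp]
      exact Finset.sum_congr rfl fun i _ => by simp [← hψz]
    · rw [show c = _ from (congrArg Prod.snd hsum).symm, Prod.snd_sum, ← e.sum_comp]
      exact Finset.sum_congr rfl fun i _ => by simp [← hψz]

lemma isCompact_convexHull_pureGraph (d k : ℕ) : IsCompact (convexHull ℝ (pureGraph d k)) :=
  isCompact_convexHull_of_isCompact ((isCompact_sphere _ _).image
    (continuous_ketBra.prodMk (continuous_pureConcurrence k)))

lemma snd_nonneg_of_mem_convexHull {d k : ℕ} {x : BipartiteMatrix d d × ℝ}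
    (hx : x ∈ convexHull ℝ (pureGraph d k)) : 0 ≤ x.2 := by
  have hsub : pureGraph d k ⊆ (LinearMap.snd ℝ (BipartiteMatrix d d) ℝ) ⁻¹' Set.Ici 0 := by
    rintro _ ⟨ψ, -, rfl⟩
    exact pureConcurrence_nonneg k ψ
  exact convexHull_min hsub ((convex_Ici 0).linear_preimage _) hx

lemma trace_eq_one_of_mem_convexHull {d k : ℕ} {x : BipartiteMatrix d d × ℝ}
    (hx : x ∈ convexHull ℝ (pureGraph d k)) : x.1.trace = 1 := by
  obtain ⟨N, p, ψ, hp, hp1, hψ, hρ, -⟩ := mem_decompositionAverages_iff.2 hx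
  rw [hρ, Matrix.trace_sum]
  simp only [Matrix.trace_smul, trace_ketBra, hψ]
  simpa using congrArg Complex.ofReal hp1

/-- The spectral decomposition supplies one ensemble, so the fibre over `ρ` is nonempty. -/
lemma exists_mem_convexHull {d : ℕ} (k : ℕ) {ρ : BipartiteMatrix d d} (hρ : IsDensity ρ) :
    ∃ c, (ρ, c) ∈ convexHull ℝ (pureGraph d k) := by
  have hH := hρ.1.1
  refine ⟨_, mem_convexHull_of_exists_fintype hH.eigenvalues
    (fun i => (ketBra (hH.eigenvectorBasis i), pureConcurrence k (hH.eigenvectorBasis i)))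
    hρ.1.eigenvalues_nonneg ?_ (fun i => mk_mem_pureGraph k (hH.eigenvectorBasis.norm_eq_one i))
    (Prod.ext ?_ rfl)⟩
  · have h := hH.trace_eq_sum_eigenvalues
    rw [hρ.2, ← RCLike.ofReal_sum, ← RCLike.ofReal_one] at h
    exact (RCLike.ofReal_injective h).symm
  · rw [Prod.fst_sum]
    refine Eq.trans ?_ (eq_eigenvectorUnitary_mul hH).symm
    ext x y
    rw [Matrix.sum_apply, Matrix.mul_apply]
    refine Finset.sum_congr rfl fun i _ => ?_
    simp only [Prod.smul_fst, Matrix.smul_apply, ketBra, Matrix.of_apply, Matrix.mul_diagonal,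
      Matrix.star_apply, Matrix.IsHermitian.eigenvectorUnitary_apply, Complex.real_smul]
    ring

/-- The minimum in the convex roof is attained. -/
theorem isLeast_concurrence {d : ℕ} (k : ℕ) {ρ : BipartiteMatrix d d} (hρ : IsDensity ρ) :
    IsLeast (decompositionAverages k ρ) (concurrence k ρ) := by
  -- The averages form the projection of a closed slice of the compact hull.
  have hset : decompositionAverages k ρ =
      Prod.snd '' (convexHull ℝ (pureGraph d k) ∩ Prod.fst ⁻¹' {ρ}) := by
    ext c
    rw [mem_decompositionAverages_iff]
    constructor
    · exact fun h => ⟨(ρ, c), ⟨h, rfl⟩, rfl⟩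
    · rintro ⟨⟨σ, e⟩, ⟨h, rfl⟩, rfl⟩
      exact h
  have hcomp : IsCompact (decompositionAverages k ρ) := by
    rw [hset]
    exact ((isCompact_convexHull_pureGraph d k).inter_right
      (isClosed_singleton.preimage continuous_fst)).image continuous_snd
  obtain ⟨c, hc⟩ := exists_mem_convexHull k hρ
  exact hcomp.isLeast_sInf ⟨c, mem_decompositionAverages_iff.2 hc⟩

lemma mk_concurrence_mem {d : ℕ} (k : ℕ) {ρ : BipartiteMatrix d d} (hρ : IsDensity ρ) :
    (ρ, concurrence k ρ) ∈ convexHull ℝ (pureGraph d k) :=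
  mem_decompositionAverages_iff.1 (isLeast_concurrence k hρ).1

lemma concurrence_le {d k : ℕ} {ρ : BipartiteMatrix d d} {c : ℝ}
    (h : (ρ, c) ∈ convexHull ℝ (pureGraph d k)) : concurrence k ρ ≤ c :=
  csInf_le ⟨0, fun _ he => snd_nonneg_of_mem_convexHull (mem_decompositionAverages_iff.1 he)⟩
    (mem_decompositionAverages_iff.2 h)

lemma pureConcurrence_eq_of_norm_inner {d k : ℕ} (hk : 1 ≤ k) {ψ φ : BipartiteVector d d}
    (hψ : ‖ψ‖ = 1) (hφ : ‖φ‖ = 1) (h : ‖inner ℂ ψ φ‖ = 1) :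
    pureConcurrence k φ = pureConcurrence k ψ := by
  have hψ0 : ψ ≠ 0 := fun h0 => by simp [h0] at hψ
  have hφ0 : φ ≠ 0 := fun h0 => by simp [h0] at hφ
  obtain ⟨r, -, rfl⟩ := (norm_inner_eq_norm_iff (𝕜 := ℂ) hψ0 hφ0).1 (by rw [h, hψ, hφ, one_mul])
  rw [norm_smul, hψ, mul_one] at hφ
  rw [pureConcurrence_smul hk, hφ, one_pow, one_mul]

/-- Taking the expectation in `ψ` gives `∑ p i * |⟨ψ, φ i⟩|² = 1`. By equality in Cauchy–Schwarz,
each `φ i` of nonzero weight is a phase multiple of `ψ`. -/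
lemma decompositionAverages_ketBra {d k : ℕ} (hk : 1 ≤ k) {ψ : BipartiteVector d d}
    (hψ : ‖ψ‖ = 1) {c : ℝ} (hc : c ∈ decompositionAverages k (ketBra ψ)) :
    c = pureConcurrence k ψ := by
  obtain ⟨N, p, φ, hp, hp1, hφ, hρ, rfl⟩ := hc
  have hle : ∀ i, ‖inner ℂ ψ (φ i)‖ ^ 2 ≤ 1 := fun i => by
    have h := norm_inner_le_norm (𝕜 := ℂ) ψ (φ i)
    rw [hψ, hφ, one_mul] at h
    exact pow_le_one₀ (norm_nonneg _) h
  have hsum : ∑ i, p i * ‖inner ℂ ψ (φ i)‖ ^ 2 = 1 := by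
    have h := star_dotProduct_ketBra_mulVec ψ ψ
    rw [hρ, Matrix.sum_mulVec, dotProduct_sum, Complex.re_sum, inner_self_eq_norm_sq_to_K, hψ] at h
    simp only [Matrix.smul_mulVec, dotProduct_smul, Complex.smul_re,
      star_dotProduct_ketBra_mulVec, smul_eq_mul] at h
    simpa using h
  have hzero : ∑ i, p i * (1 - ‖inner ℂ ψ (φ i)‖ ^ 2) = 0 := by
    simp only [mul_sub, mul_one, Finset.sum_sub_distrib, hp1, hsum, sub_self]
  have heach := (Finset.sum_eq_zero_iff_of_nonneg fun i _ =>
    mul_nonneg (hp i) (sub_nonneg.2 (hle i))).1 hzero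
  rw [← one_mul (pureConcurrence k ψ), ← hp1, Finset.sum_mul]
  refine Finset.sum_congr rfl fun i hi => ?_
  rcases mul_eq_zero.1 (heach i hi) with h | h
  · rw [h, zero_mul, zero_mul]
  · have h1 : ‖inner ℂ ψ (φ i)‖ = 1 :=
      (pow_eq_one_iff_of_nonneg (norm_nonneg _) two_ne_zero).1 (sub_eq_zero.1 h).symm
    rw [pureConcurrence_eq_of_norm_inner hk hψ (hφ i) h1]

/-- The convex roof extends `C_k` from the pure states. -/
theorem concurrence_ketBra {d k : ℕ} (hk : 1 ≤ k) {ψ : BipartiteVector d d} (hψ : ‖ψ‖ = 1) :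
    concurrence k (ketBra ψ) = pureConcurrence k ψ := by
  have hset : decompositionAverages k (ketBra ψ) = {pureConcurrence k ψ} :=
    Set.eq_singleton_iff_unique_mem.2 ⟨mem_decompositionAverages_iff.2
      (subset_convexHull ℝ _ (mk_mem_pureGraph k hψ)), fun _ => decompositionAverages_ketBra hk hψ⟩
  rw [concurrence, hset, csInf_singleton]

lemma convex_setOf_isDensity {ι : Type} [Fintype ι] :
    Convex ℝ {ρ : Matrix ι ι ℂ | IsDensity ρ} := by
  intro ρ hρ σ hσ a b ha hb hab
  refine ⟨(hρ.1.smul ha).add (hσ.1.smul hb), ?_⟩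
  rw [Matrix.trace_add, Matrix.trace_smul, Matrix.trace_smul, hρ.2, hσ.2, ← add_smul, hab, one_smul]

lemma convexOn_concurrence (d k : ℕ) :
    ConvexOn ℝ {ρ : BipartiteMatrix d d | IsDensity ρ} (concurrence k) :=
  ⟨convex_setOf_isDensity, fun _ hρ _ hσ _ _ ha hb hab => concurrence_le
    ((convex_convexHull ℝ _) (mk_concurrence_mem k hρ) (mk_concurrence_mem k hσ) ha hb hab)⟩

/-! ### The function `f_k` -/

lemma pureConcurrence_eq_spectralConcurrence {d : ℕ} (k : ℕ) (ψ : BipartiteVector d d) :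
    pureConcurrence k ψ = spectralConcurrence k (partialTraceB (ketBra ψ)) := by
  rw [partialTraceB_ketBra, spectralConcurrence_eq k (Matrix.posSemidef_self_mul_conjTranspose _),
    pureConcurrence_eq]

lemma spectralConcurrence_conj {d : ℕ} (k : ℕ) {U : Matrix (Fin d) (Fin d) ℂ}
    (hU : U ∈ Matrix.unitaryGroup (Fin d) ℂ) {σ : Matrix (Fin d) (Fin d) ℂ}
    (hσ : σ.PosSemidef) :
    spectralConcurrence k (U * σ * star U) = spectralConcurrence k σ := by
  have hpsd : (U * σ * star U).PosSemidef := hσ.mul_mul_conjTranspose_same U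
  rw [spectralConcurrence_eq k hpsd, spectralConcurrence_eq k hσ, rootEsym,
    matEsym_conj (Matrix.mem_unitaryGroup_iff'.1 hU), rootEsym]

lemma concaveOn_spectralConcurrence (d : ℕ) {k : ℕ} (hk : 1 ≤ k) :
    ConcaveOn ℝ {σ : Matrix (Fin d) (Fin d) ℂ | IsDensity σ} (spectralConcurrence k) := by
  refine ⟨convex_setOf_isDensity, fun ρ hρ σ hσ a b ha hb _ => ?_⟩
  rw [spectralConcurrence_eq k hρ.1, spectralConcurrence_eq k hσ.1,
    spectralConcurrence_eq k ((hρ.1.smul ha).add (hσ.1.smul hb)), smul_eq_mul, smul_eq_mul,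
    ← mul_div_assoc, ← mul_div_assoc, ← add_div, ← rootEsym_smul hk ha hρ.1,
    ← rootEsym_smul hk hb hσ.1]
  exact div_le_div_of_nonneg_right (rootEsym_superadditive hk (hρ.1.smul ha) (hσ.1.smul hb))
    (uniformRoot_nonneg d k)

/-! ### Monotonicity under local operations and classical communication -/

/-- The unnormalised pure state with coefficient matrix `A`. -/
def matKetBra {m n : ℕ} (A : Matrix (Fin m) (Fin n) ℂ) : BipartiteMatrix m n :=
  Matrix.vecMulVec (Matrix.vec Aᵀ) (star (Matrix.vec Aᵀ))

lemma ketBra_eq_matKetBra {d : ℕ} (ψ : BipartiteVector d d) :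
    ketBra ψ = matKetBra (coeffMatrix ψ) := rfl

lemma mul_vecMulVec_star_mul {α β : Type*} [Fintype α] [Fintype β] (M : Matrix α β ℂ)
    (v : β → ℂ) :
    M * Matrix.vecMulVec v (star v) * Mᴴ = Matrix.vecMulVec (M *ᵥ v) (star (M *ᵥ v)) := by
  rw [Matrix.mul_vecMulVec, Matrix.vecMulVec_mul, Matrix.star_mulVec]

lemma alice_matKetBra {m m' n : ℕ} (K : Matrix (Fin m') (Fin m) ℂ)
    (A : Matrix (Fin m) (Fin n) ℂ) :
    (K ⊗ₖ (1 : Matrix (Fin n) (Fin n) ℂ)) * matKetBra A *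
      (K ⊗ₖ (1 : Matrix (Fin n) (Fin n) ℂ))ᴴ = matKetBra (K * A) := by
  rw [matKetBra, mul_vecMulVec_star_mul, Matrix.kronecker_mulVec_vec, Matrix.one_mul, matKetBra,
    Matrix.transpose_mul]

lemma bob_matKetBra {m n n' : ℕ} (K : Matrix (Fin n') (Fin n) ℂ)
    (A : Matrix (Fin m) (Fin n) ℂ) :
    ((1 : Matrix (Fin m) (Fin m) ℂ) ⊗ₖ K) * matKetBra A *
      ((1 : Matrix (Fin m) (Fin m) ℂ) ⊗ₖ K)ᴴ = matKetBra (A * Kᵀ) := by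
  rw [matKetBra, mul_vecMulVec_star_mul, Matrix.kronecker_mulVec_vec, Matrix.transpose_one,
    Matrix.mul_one, matKetBra, Matrix.transpose_mul, Matrix.transpose_transpose]

/-- The pairs `(ρ, c)` such that `ρ` is a sum of unnormalised pure states whose values of
`S_k ^ (1/k)` add up to `c`. -/
def rootCone (k m n : ℕ) : AddSubmonoid (BipartiteMatrix m n × ℝ) :=
  AddSubmonoid.closure (Set.range fun A : Matrix (Fin m) (Fin n) ℂ =>
    (matKetBra A, rootEsym k (A * Aᴴ)))

lemma mk_mem_rootCone {m n : ℕ} (k : ℕ) (A : Matrix (Fin m) (Fin n) ℂ) :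
    (matKetBra A, rootEsym k (A * Aᴴ)) ∈ rootCone k m n :=
  AddSubmonoid.subset_closure ⟨A, rfl⟩

lemma mk_sum_mem_rootCone {ι : Type*} {k m n : ℕ} {s : Finset ι} {ρ : ι → BipartiteMatrix m n}
    {c : ι → ℝ} (h : ∀ i ∈ s, (ρ i, c i) ∈ rootCone k m n) :
    (∑ i ∈ s, ρ i, ∑ i ∈ s, c i) ∈ rootCone k m n := by
  have hsum : (∑ i ∈ s, ρ i, ∑ i ∈ s, c i) = ∑ i ∈ s, (ρ i, c i) :=
    Prod.ext (by simp [Prod.fst_sum]) (by simp [Prod.snd_sum])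
  rw [hsum]
  exact sum_mem h

/-- Both the Kraus map and the claimed bound are additive, so it is enough to check the bound on the
generators, which are pure states. -/
lemma exists_rootCone_of_kraus {m n m' n' r k : ℕ} {L : Fin r → ℕ}
    (M : (j : Fin r) → Fin (L j) → Matrix (Fin m' × Fin n') (Fin m × Fin n) ℂ)
    (B : (j : Fin r) → Fin (L j) → Matrix (Fin m) (Fin n) ℂ → Matrix (Fin m') (Fin n') ℂ)
    (hB : ∀ j l A, M j l * matKetBra A * (M j l)ᴴ = matKetBra (B j l A))
    (hle : ∀ A, ∑ j, ∑ l, rootEsym k (B j l A * (B j l A)ᴴ) ≤ rootEsym k (A * Aᴴ))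
    {x : BipartiteMatrix m n × ℝ} (hx : x ∈ rootCone k m n) :
    ∃ c : Fin r → ℝ, (∀ j, (∑ l, M j l * x.1 * (M j l)ᴴ, c j) ∈ rootCone k m' n') ∧
      ∑ j, c j ≤ x.2 := by
  induction hx using AddSubmonoid.closure_induction with
  | mem x hx =>
    obtain ⟨A, rfl⟩ := hx
    refine ⟨fun j => ∑ l, rootEsym k (B j l A * (B j l A)ᴴ), fun j => ?_, hle A⟩
    refine mk_sum_mem_rootCone fun l _ => ?_
    rw [hB]
    exact mk_mem_rootCone k _
  | zero =>
    refine ⟨0, fun j => ?_, by simp⟩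
    have h : ((∑ l, M j l * (0 : BipartiteMatrix m n × ℝ).1 * (M j l)ᴴ,
        (0 : Fin r → ℝ) j) : BipartiteMatrix m' n' × ℝ) = 0 := by simp
    rw [h]
    exact zero_mem _
  | add x y _ _ hx hy =>
    obtain ⟨c, hc, hcx⟩ := hx
    obtain ⟨e, he, hey⟩ := hy
    refine ⟨c + e, fun j => ?_, ?_⟩
    · have h := add_mem (hc j) (he j)
      rw [Prod.mk_add_mk, ← Finset.sum_add_distrib] at h
      simpa only [Prod.fst_add, Matrix.mul_add, Matrix.add_mul, Pi.add_apply] using h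
    · simp only [Pi.add_apply, Finset.sum_add_distrib, Prod.snd_add]
      exact add_le_add hcx hey

lemma sum_sum_rootEsym_le {n : Type*} [Fintype n] [DecidableEq n] {k r : ℕ} (hk : 1 ≤ k)
    {L : Fin r → ℕ} (A : (j : Fin r) → Fin (L j) → Matrix n n ℂ)
    (hA : ∀ j l, (A j l).PosSemidef) :
    ∑ j, ∑ l, rootEsym k (A j l) ≤ rootEsym k (∑ j, ∑ l, A j l) :=
  (Finset.sum_le_sum fun j _ => rootEsym_sum_le hk Finset.univ (A j) (hA j)).trans
    (rootEsym_sum_le hk Finset.univ _ fun j => Matrix.posSemidef_sum _ fun l _ => hA j l)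

/-- Passing from `X * Xᴴ` to `Xᴴ * X`, that is, to Bob's side, places `Kᴴ * K` in the middle, where
completeness sums it to the identity. -/
lemma alice_rootEsym_le {m m' n r k : ℕ} (hk : 1 ≤ k) (I : Instrument m m' r)
    (A : Matrix (Fin m) (Fin n) ℂ) :
    ∑ j, ∑ l, rootEsym k (I.kraus j l * A * (I.kraus j l * A)ᴴ) ≤ rootEsym k (A * Aᴴ) := by
  simp only [fun j l => rootEsym_mul_comm k (I.kraus j l * A) (I.kraus j l * A)ᴴ]
  rw [rootEsym_mul_comm k A Aᴴ]
  refine (sum_sum_rootEsym_le hk _ fun j l => Matrix.posSemidef_conjTranspose_mul_self _).trans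
    (le_of_eq ?_)
  congr 1
  have h : ∀ j l, (I.kraus j l * A)ᴴ * (I.kraus j l * A) =
      Aᴴ * ((I.kraus j l)ᴴ * I.kraus j l) * A := fun j l => by
    simp only [Matrix.conjTranspose_mul, Matrix.mul_assoc]
  simp only [h, ← Matrix.mul_sum, ← Matrix.sum_mul, I.complete, Matrix.mul_one]

/-- Here no swap is needed: up to a transpose, `Kᴴ * K` is already in the middle, reflecting that
Bob's operation preserves Alice's average state. -/
lemma bob_rootEsym_le {m n n' r k : ℕ} (hk : 1 ≤ k) (I : Instrument n n' r)
    (A : Matrix (Fin m) (Fin n) ℂ) :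
    ∑ j, ∑ l, rootEsym k (A * (I.kraus j l)ᵀ * (A * (I.kraus j l)ᵀ)ᴴ) ≤ rootEsym k (A * Aᴴ) := by
  refine (sum_sum_rootEsym_le hk _ fun j l => Matrix.posSemidef_self_mul_conjTranspose _).trans
    (le_of_eq ?_)
  congr 1
  have h : ∀ j l, A * (I.kraus j l)ᵀ * (A * (I.kraus j l)ᵀ)ᴴ =
      A * ((I.kraus j l)ᴴ * I.kraus j l)ᵀ * Aᴴ := fun j l => by
    rw [Matrix.conjTranspose_mul, Matrix.transpose_mul,
      Matrix.conjTranspose_transpose_eq_transpose_conjTranspose]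
    simp only [Matrix.mul_assoc]
  simp only [h, ← Matrix.mul_sum, ← Matrix.sum_mul, ← Matrix.transpose_sum, I.complete,
    Matrix.transpose_one, Matrix.mul_one]

/-- LOCC does not increase the sum of the values of `S_k ^ (1/k)` in a decomposition into
unnormalised pure states. -/
theorem IsLOCC.exists_rootCone {m n m' n' r k : ℕ} (hk : 1 ≤ k)
    {Λ : Fin r → BipartiteMatrix m n → BipartiteMatrix m' n'} (hΛ : IsLOCC Λ)
    {ρ : BipartiteMatrix m n} {c : ℝ} (h : (ρ, c) ∈ rootCone k m n) :
    ∃ e : Fin r → ℝ, (∀ j, (Λ j ρ, e j) ∈ rootCone k m' n') ∧ ∑ j, e j ≤ c := by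
  induction hΛ generalizing c with
  | alice I =>
    exact exists_rootCone_of_kraus (x := (ρ, c)) (fun j l => I.kraus j l ⊗ₖ 1)
      (fun j l A => I.kraus j l * A)
      (fun j l A => alice_matKetBra _ _) (alice_rootEsym_le hk I) h
  | bob I =>
    exact exists_rootCone_of_kraus (x := (ρ, c)) (fun j l => 1 ⊗ₖ I.kraus j l)
      (fun j l A => A * (I.kraus j l)ᵀ)
      (fun j l A => bob_matKetBra _ _) (bob_rootEsym_le hk I) h
  | link Λ Γ g hΛ hΓ ihΛ ihΓ =>
    obtain ⟨e, he, hec⟩ := ihΛ h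
    choose f hf hfe using fun i => ihΓ i (he i)
    refine ⟨fun q => ∑ x with g x = q, f x.1 x.2,
      fun q => mk_sum_mem_rootCone fun x _ => hf x.1 x.2, ?_⟩
    -- Relabelling only groups outcomes, so the total over the fibres of `g` is the total over all
    -- joint outcomes.
    rw [Finset.sum_fiberwise, Fintype.sum_sigma]
    exact (Finset.sum_le_sum fun i _ => hfe i).trans hec

lemma exists_coeffMatrix_eq {d : ℕ} (A : Matrix (Fin d) (Fin d) ℂ) :
    ∃ ψ : BipartiteVector d d, coeffMatrix ψ = A :=
  ⟨WithLp.toLp 2 fun x => A x.1 x.2, rfl⟩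

/-- The way back from unnormalised ensembles to the convex hull: the factor `t` will turn out to be
the outcome probability. -/
lemma exists_smul_mem_convexHull {d k : ℕ} (hk : 1 ≤ k) (hkd : k ≤ d)
    {x : BipartiteMatrix d d × ℝ} (hx : x ∈ rootCone k d d) :
    ∃ t : ℝ, 0 ≤ t ∧ ∃ y ∈ convexHull ℝ (pureGraph d k),
      (x.1, x.2 / uniformRoot d k) = t • y := by
  induction hx using AddSubmonoid.closure_induction with
  | mem x hx =>
    obtain ⟨A, rfl⟩ := hx
    obtain ⟨ψ, rfl⟩ := exists_coeffMatrix_eq A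
    have hunit : ∃ φ : BipartiteVector d d, ‖φ‖ = 1 ∧ ψ = (‖ψ‖ : ℂ) • φ := by
      rcases eq_or_ne ψ 0 with rfl | h
      -- For `ψ = 0` any unit vector serves; one exists because `1 ≤ k ≤ d`.
      · let i : Fin d := ⟨0, by omega⟩
        exact ⟨EuclideanSpace.single (i, i) 1, by simp, by simp⟩
      · have h0 : (‖ψ‖ : ℂ) ≠ 0 := by simpa using h
        refine ⟨(‖ψ‖ : ℂ)⁻¹ • ψ, ?_, ?_⟩
        · rw [norm_smul, norm_inv, Complex.norm_real, norm_norm,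
            inv_mul_cancel₀ (norm_ne_zero_iff.2 h)]
        · rw [smul_smul, mul_inv_cancel₀ h0, one_smul]
    obtain ⟨φ, hφ, hψφ⟩ := hunit
    refine ⟨‖(‖ψ‖ : ℂ)‖ ^ 2, by positivity, _, subset_convexHull ℝ _ (mk_mem_pureGraph k hφ), ?_⟩
    dsimp only
    rw [← pureConcurrence_eq, ← ketBra_eq_matKetBra, Prod.smul_mk, ← ketBra_smul, smul_eq_mul,
      ← pureConcurrence_smul hk, ← hψφ]
  | zero =>
    let i : Fin d := ⟨0, by omega⟩
    exact ⟨0, le_rfl, _, subset_convexHull ℝ _ (mk_mem_pureGraph k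
      (ψ := EuclideanSpace.single (i, i) 1) (by simp)), by simp⟩
  | add x y _ _ hx hy =>
    obtain ⟨t, ht, x', hx', hxt⟩ := hx
    obtain ⟨s, hs, y', hy', hys⟩ := hy
    have hadd : ((x + y).1, (x + y).2 / uniformRoot d k) = t • x' + s • y' := by
      rw [← hxt, ← hys]
      exact Prod.ext rfl (add_div _ _ _)
    rw [hadd]
    rcases (add_nonneg ht hs).eq_or_lt with h0 | h0
    · obtain ⟨rfl, rfl⟩ := (add_eq_zero_iff_of_nonneg ht hs).1 h0.symm
      exact ⟨0, le_rfl, x', hx', by simp⟩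
    · refine ⟨t + s, h0.le, (t / (t + s)) • x' + (s / (t + s)) • y',
        (convex_convexHull ℝ _) hx' hy' (by positivity) (by positivity)
          (by rw [← add_div, div_self h0.ne']), ?_⟩
      rw [smul_add, smul_smul, smul_smul, mul_div_cancel₀ _ h0.ne', mul_div_cancel₀ _ h0.ne']

lemma outcomeProb_mul_concurrence_le {d k : ℕ} (hk : 1 ≤ k) (hkd : k ≤ d)
    {σ : BipartiteMatrix d d} {c : ℝ} (h : (σ, c) ∈ rootCone k d d) :
    outcomeProb σ * concurrence k (outcomeState σ) ≤ c / uniformRoot d k := by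
  obtain ⟨t, ht, ⟨τ, e⟩, hy, hxy⟩ := exists_smul_mem_convexHull hk hkd h
  obtain ⟨h1, h2⟩ := Prod.ext_iff.1 hxy
  simp only [Prod.smul_mk, smul_eq_mul] at h1 h2
  have hprob : outcomeProb σ = t := by
    rw [outcomeProb, h1, Matrix.trace_smul, trace_eq_one_of_mem_convexHull hy]
    simp
  rw [h2, hprob]
  -- At probability zero the product vanishes, whatever value `concurrence` takes at the meaningless
  -- state.
  rcases ht.eq_or_lt with rfl | ht
  · simp
  · have hstate : outcomeState σ = τ := by
      rw [outcomeState, hprob, h1, smul_smul, inv_mul_cancel₀ ht.ne', one_smul]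
    rw [hstate]
    exact mul_le_mul_of_nonneg_left (concurrence_le hy) ht.le

lemma mk_mem_rootCone_of_mem_convexHull {d k : ℕ} (hk : 1 ≤ k) (hkd : k ≤ d)
    {ρ : BipartiteMatrix d d} {c : ℝ} (h : (ρ, c) ∈ convexHull ℝ (pureGraph d k)) :
    (ρ, c * uniformRoot d k) ∈ rootCone k d d := by
  obtain ⟨N, p, ψ, hp, -, -, rfl, rfl⟩ := mem_decompositionAverages_iff.2 h
  rw [Finset.sum_mul]
  refine mk_sum_mem_rootCone fun i _ => ?_
  have hnorm : ‖((√(p i) : ℝ) : ℂ)‖ ^ 2 = p i := by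
    rw [Complex.norm_real, Real.norm_eq_abs, sq_abs, Real.sq_sqrt (hp i)]
  have hmem := mk_mem_rootCone k (coeffMatrix (((√(p i) : ℝ) : ℂ) • ψ i))
  rw [← ketBra_eq_matKetBra, ketBra_smul, coeffMatrix_mul_conjTranspose_smul, hnorm,
    rootEsym_smul hk (hp i) (Matrix.posSemidef_self_mul_conjTranspose _)] at hmem
  rwa [pureConcurrence_eq, mul_assoc, div_mul_cancel₀ _ (uniformRoot_pos hk hkd).ne']

theorem isEntanglementMonotone_concurrence {d k : ℕ} (hk : 1 ≤ k) (hkd : k ≤ d) :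
    IsEntanglementMonotone (concurrence k : BipartiteMatrix d d → ℝ) where
  convex := convexOn_concurrence d k
  average_le Λ hΛ ρ hρ := by
    obtain ⟨e, he, hle⟩ := hΛ.exists_rootCone hk
      (mk_mem_rootCone_of_mem_convexHull hk hkd (mk_concurrence_mem k hρ))
    calc ∑ j, outcomeProb (Λ j ρ) * concurrence k (outcomeState (Λ j ρ))
        ≤ ∑ j, e j / uniformRoot d k :=
          Finset.sum_le_sum fun j _ => outcomeProb_mul_concurrence_le hk hkd (he j)
      _ = (∑ j, e j) / uniformRoot d k := (Finset.sum_div _ _ _).symm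
      _ ≤ concurrence k ρ := (div_le_iff₀ (uniformRoot_pos hk hkd)).2 hle

end Concurrence

end

theorem mainTheorem3 (d k : ℕ) (hk : 1 ≤ k) (hkd : k ≤ d) :
    -- the minimum in the convex roof exists, and the roof extends `C_k` from pure states
    (∀ ρ : Concurrence.BipartiteMatrix d d, Concurrence.IsDensity ρ →
      IsLeast (Concurrence.decompositionAverages k ρ) (Concurrence.concurrence k ρ)) ∧
    (∀ ψ : Concurrence.BipartiteVector d d, ‖ψ‖ = 1 →
      Concurrence.concurrence k (Concurrence.ketBra ψ) = Concurrence.pureConcurrence k ψ) ∧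
    -- `C_k(ψ) = f_k(Tr_B |ψ⟩⟨ψ|)` with `f_k` unitarily invariant and concave
    (∀ ψ : Concurrence.BipartiteVector d d, ‖ψ‖ = 1 →
      Concurrence.pureConcurrence k ψ =
        Concurrence.spectralConcurrence k
          (Concurrence.partialTraceB (Concurrence.ketBra ψ))) ∧
    (∀ U ∈ Matrix.unitaryGroup (Fin d) ℂ, ∀ σ : Matrix (Fin d) (Fin d) ℂ,
      Concurrence.IsDensity σ →
      Concurrence.spectralConcurrence k (U * σ * star U) =
        Concurrence.spectralConcurrence k σ) ∧
    ConcaveOn ℝ {σ : Matrix (Fin d) (Fin d) ℂ | Concurrence.IsDensity σ}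
      (Concurrence.spectralConcurrence k) ∧
    -- `C_k` is an entanglement monotone
    Concurrence.IsEntanglementMonotone
      (Concurrence.concurrence k : Concurrence.BipartiteMatrix d d → ℝ) :=
  ⟨fun _ hρ => Concurrence.isLeast_concurrence k hρ,
    fun _ hψ => Concurrence.concurrence_ketBra hk hψ,
    fun ψ _ => Concurrence.pureConcurrence_eq_spectralConcurrence k ψ,
    fun _ hU _ hσ => Concurrence.spectralConcurrence_conj k hU hσ.1,
    Concurrence.concaveOn_spectralConcurrence d hk,
    Concurrence.isEntanglementMonotone_concurrence hk hkd⟩
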